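/- Let $m\ge 3$ be odd, $q=2^m$, and let $\alpha_0=0,\alpha_1=1,\alpha_2,\dots,\alpha_{q-1}$ be all the elements of $\mathbb F_q$. Let $\mathcal C\subseteq\mathbb F_q^{q+4}$ be the linear code generated by the rows of $$ G_1=\begin{bmatrix} 1 & 1 & \cdots & 1 & 1 & 0 & 0 & 1 & 0\\ \alpha_1 & \alpha_2 & \cdots & \alpha_{q-1} & 0 & 0 & 1 & 0 & 1\\ \alpha_1^2 & \alpha_2^2 & \cdots & \alpha_{q-1}^2 & 0 & 1 & 0 & 1 & 1 \end{bmatrix}, $$ and let $\mathcal C^\perp$ be its dual with respect to the Euclidean inner product. A linear code $\mathcal D\subseteq\mathbb F_q^n$ of dimension $k$ and minimum Hamming distance $d$ is called an $[n,k,d]$ code. It is almost MDS if $d=n-k$, and near MDS (NMDS) if both $\mathcal D$ and $\mathcal D^\perp$ are almost MDS. It is an $(n,k,d,q;r)$-LRC if for every coordinate $i$ there are a set $R_i$ of exactly $r$ coordinates with $i\notin R_i$ and a function $f_i:\mathbb F_q^{r}\to\mathbb F_q$ such that $c_i=f_i\big((c_j)_{j\in R_i}\big)$ for every $c\in\mathcal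 D$. An $(n,k,d,q;r)$-LRC is $d$-optimal if it attains the Singleton-like bound, that is, $$d=n-k-\left\lceil \tfrac{k}{r}\right\rceil+2,$$ and $k$-optimal if it attains the Cadambe–Mazumdar bound, that is, $$k=\min_{t\in\mathbb Z_{>0}}\big[rt+k^{(q)}_{\rm opt}(n-t(r+1),d)\big],$$ where $k^{(q)}_{\rm opt}(n',d)$ is the largest dimension of a linear code over $\mathbb F_q$ of length $n'$ and minimum distance $d$ (and $0$ if there is no such code, in particular if $n'\le 0$). Then $\mathcal C$ is an NMDS code and a $(q+4,3,q+1,q;2)$-LRC, and $\mathcal C^\perp$ is a $(q+4,q+1,3,q;q)$-LRC. Moreover, with these parameters, $\mathcal C$ and $\mathcal C^\perp$ are both $d$-optimal and $k$-optimal. -/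

import Mathlib

namespace LocallyRecoverable

/-- `C` is an `[n, k, d]` linear code: its dimension is `k`, and `d` is the least Hamming distance
between two distinct codewords. (The zero code has no minimum distance.) -/
def HasParameters {F : Type*} [Field F] [DecidableEq F] {n : ℕ}
    (C : Submodule F (Fin n → F)) (k d : ℕ) : Prop :=
  Module.finrank F C = k ∧
    IsLeast {w : ℕ | ∃ x ∈ C, ∃ y ∈ C, x ≠ y ∧ hammingDist x y = w} d

/-- The dual code with respect to the Euclidean inner product. -/
def dualCode {F : Type*} [Field F] {n : ℕ} (C : Submodule F (Fin n → F)) :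
    Submodule F (Fin n → F) where
  carrier := {x | ∀ c ∈ C, x ⬝ᵥ c = 0}
  add_mem' hx hy c hc := by rw [add_dotProduct, hx c hc, hy c hc, add_zero]
  zero_mem' c _ := zero_dotProduct c
  smul_mem' a x hx c hc := by rw [smul_dotProduct, hx c hc, smul_zero]

/-- Almost MDS codes: parameters `[n, k, n - k]`. -/
def IsAMDS {F : Type*} [Field F] [DecidableEq F] {n : ℕ}
    (C : Submodule F (Fin n → F)) : Prop :=
  ∃ k d : ℕ, HasParameters C k d ∧ d + k = n

/-- Near MDS codes: the code and its dual are both almost MDS. -/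
def IsNMDS {F : Type*} [Field F] [DecidableEq F] {n : ℕ}
    (C : Submodule F (Fin n → F)) : Prop :=
  IsAMDS C ∧ IsAMDS (dualCode C)

/-- Every coordinate `i` of a codeword is a function of the coordinates in some repair set
`R` of size `r` that does not contain `i`. -/
def HasLocality {F : Type*} [Field F] {n : ℕ} (C : Submodule F (Fin n → F)) (r : ℕ) : Prop :=
  ∀ i : Fin n, ∃ R : Finset (Fin n), i ∉ R ∧ R.card = r ∧
    ∃ f : (R → F) → F, ∀ c ∈ C, c i = f (fun j : R => c j)

/-- `C` is an `(n, k, d, q; r)`-LRC. -/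
def IsLRC {F : Type*} [Field F] [DecidableEq F] {n : ℕ}
    (C : Submodule F (Fin n → F)) (k d q r : ℕ) : Prop :=
  Nat.card F = q ∧ HasParameters C k d ∧ HasLocality C r

/-- Largest dimension of a linear code over `F` of length `n` and minimum distance `d`;
it is `0` if there is no such code (other than the zero code). -/
noncomputable def kOpt (F : Type*) [Field F] [DecidableEq F] (n d : ℕ) : ℕ :=
  sSup {k : ℕ | ∃ D : Submodule F (Fin n → F), HasParameters D k d}

/-- An `(n, k, d, q; r)`-LRC that is distance-optimal: equality in the Singleton-like bound
`d ≤ n - k - ⌈k / r⌉ + 2`. -/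
def IsDOptimalLRC {F : Type*} [Field F] [DecidableEq F] {n : ℕ}
    (C : Submodule F (Fin n → F)) (k d q r : ℕ) : Prop :=
  IsLRC C k d q r ∧ (d : ℤ) = (n : ℤ) - (k : ℤ) - ⌈(k : ℚ) / (r : ℚ)⌉ + 2

/-- An `(n, k, d, q; r)`-LRC that is dimension-optimal: equality in the Cadambe-Mazumdar bound
`k ≤ min_{t ≥ 1} (r t + k_opt(n - t (r + 1), d))`. When `n - t (r + 1)` is not positive, the
truncated difference is `0` and the term `k_opt` is `0`. -/
def IsKOptimalLRC {F : Type*} [Field F] [DecidableEq F] {n : ℕ}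
    (C : Submodule F (Fin n → F)) (k d q r : ℕ) : Prop :=
  IsLRC C k d q r ∧
    IsLeast {b : ℕ | ∃ t : ℕ, 1 ≤ t ∧ b = r * t + kOpt F (n - t * (r + 1)) d} k

/-- The `3 × (q + 4)` matrix whose columns are, in this order, `(1, α_i, α_i²)` for
`i = 1, …, q - 1`, then `(1, 0, 0)`, `(0, 0, 1)`, `(0, 1, 0)`, `(1, 0, 1)`, `(0, 1, 1)`. -/
def genMatrix {F : Type*} [Field F] {q : ℕ} (α : Fin q → F) :
    Matrix (Fin 3) (Fin (q + 4)) F :=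
  Matrix.of fun row j =>
    (if h : (j : ℕ) + 1 < q then ![1, α ⟨j + 1, h⟩, α ⟨j + 1, h⟩ ^ 2]
    else if (j : ℕ) + 1 = q then ![1, 0, 0]
    else if (j : ℕ) = q then ![0, 0, 1]
    else if (j : ℕ) = q + 1 then ![0, 1, 0]
    else if (j : ℕ) = q + 2 then ![1, 0, 1]
    else ![0, 1, 1]) row

/-- The linear code with generator matrix `G`: the span of the rows of `G`. -/
def rowCode {F : Type*} [Field F] {k n : ℕ} (G : Matrix (Fin k) (Fin n) F) :
    Submodule F (Fin n → F) :=
  Submodule.span F (Set.range fun i => G i)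

end LocallyRecoverable

/-!
The columns of the generator matrix are points of the projective plane over `F`: the `q + 1` points
of the conic `y² = xz`, its nucleus `(0, 1, 0)`, and the two points `E₁ = (1, 0, 1)` and
`E₂ = (0, 1, 1)`. In characteristic two the conic and its nucleus form a hyperoval, so a line meets
them in at most two points. The line through `E₁` and `E₂` is `x + y + z = 0`; it misses the
hyperoval, because `1 + a + a²` has no root in `F` when the degree `m` is odd. Hence no line contains
more than three of the `q + 4` points (`Point.exists_eq_of_dotProduct_eq_zero`). A nonzero codeword
of `C` is a line, and its zeros are the points on that line, so `C` has parameters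
`[q + 4, 3, q + 1]`. The words of weight three in the dual code are the collinear triples of points;
as no two points coincide, the dual code has parameters `[q + 4, q + 1, 3]`.

A word `w` of weight `r + 1` orthogonal to a code gives a repair set of size `r` for every coordinate
in the support of `w` (`hasLocality_of_orthogonal`). For `C`, every point lies on a line with three
points (`Point.exists_collinear`); for the dual code, every point is off some such line
(`Point.exists_line`).

Both codes have length `n = d + r + 1` and dimension `k = r + 1`. For `r ≥ 2` this gives equality in
the Singleton-like bound, and also in the Cadambe–Mazumdar bound, where `t = 1` is optimal since
`k_opt(d, d) = 1` (`kOpt_self`).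
-/

namespace LocallyRecoverable

/-! ### Parameters, locality and optimality of linear codes -/

section Codes

variable {F : Type*} [Field F] [DecidableEq F] {n : ℕ}

theorem hasParameters_of_hammingNorm {C : Submodule F (Fin n → F)} {k d : ℕ}
    (hk : Module.finrank F C = k) (hle : ∀ x ∈ C, x ≠ 0 → d ≤ hammingNorm x)
    (hex : ∃ x ∈ C, x ≠ 0 ∧ hammingNorm x = d) : HasParameters C k d := by
  refine ⟨hk, ?_, ?_⟩
  · obtain ⟨x, hx, hx0, hd⟩ := hex
    exact ⟨x, hx, 0, C.zero_mem, hx0, by rw [hammingDist_zero_right, hd]⟩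
  · rintro w ⟨x, hx, y, hy, hxy, rfl⟩
    rw [hammingDist_comm, hammingDist_eq_hammingNorm]
    exact hle _ (by simpa [neg_add_eq_sub] using C.sub_mem hx hy)
      (by simpa [neg_add_eq_sub, sub_eq_zero] using hxy)

/-- A code of length `n` and minimum distance `n` embeds into `F` by any coordinate, and the
repetition code attains dimension `1`. -/
theorem kOpt_self (hn : 1 ≤ n) : kOpt F n n = 1 := by
  have hle : ∀ k ∈ {k : ℕ | ∃ D : Submodule F (Fin n → F), HasParameters D k n}, k ≤ 1 := by
    rintro k ⟨D, rfl, hD⟩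
    let φ : D →ₗ[F] F := (LinearMap.proj (⟨0, hn⟩ : Fin n)).comp D.subtype
    have hφ : Function.Injective φ := by
      intro x y hxy
      by_contra hne
      have h1 : n ≤ hammingDist (x : Fin n → F) y :=
        hD.2 ⟨x, x.2, y, y.2, fun h => hne (Subtype.ext h), rfl⟩
      have h2 : hammingDist (x : Fin n → F) y < n := by
        have : (Finset.univ.filter fun i => (x : Fin n → F) i ≠ (y : Fin n → F) i).card
            < (Finset.univ : Finset (Fin n)).card :=
          Finset.card_lt_card (Finset.filter_ssubset.2
            ⟨⟨0, hn⟩, Finset.mem_univ _, fun h => h hxy⟩)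
        simpa [hammingDist] using this
      omega
    simpa using LinearMap.finrank_le_finrank_of_injective hφ
  have hmem : 1 ∈ {k : ℕ | ∃ D : Submodule F (Fin n → F), HasParameters D k n} := by
    have hone : (fun _ => 1 : Fin n → F) ≠ 0 := fun h => one_ne_zero (congrFun h ⟨0, hn⟩)
    refine ⟨Submodule.span F {fun _ => 1}, hasParameters_of_hammingNorm
      (finrank_span_singleton hone) ?_ ⟨_, Submodule.mem_span_singleton_self _, hone, ?_⟩⟩
    · intro x hx hx0
      obtain ⟨a, rfl⟩ := Submodule.mem_span_singleton.1 hx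
      have ha : a ≠ 0 := by
        rintro rfl
        simp at hx0
      simp [hammingNorm, ha]
    · simp [hammingNorm]
  exact le_antisymm (csSup_le ⟨1, hmem⟩ hle) (le_csSup ⟨1, hle⟩ hmem)

/-- A word of weight `r + 1` orthogonal to the code expresses each coordinate of its support through
the `r` other ones. -/
theorem hasLocality_of_orthogonal {C : Submodule F (Fin n → F)} {r : ℕ}
    (h : ∀ i, ∃ w : Fin n → F, (∀ c ∈ C, w ⬝ᵥ c = 0) ∧ hammingNorm w = r + 1 ∧ w i ≠ 0) :
    HasLocality C r := by
  intro i
  obtain ⟨w, hw, hr, hi⟩ := h i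
  have hi' : i ∈ Finset.univ.filter fun j => w j ≠ 0 := by simpa using hi
  refine ⟨(Finset.univ.filter fun j => w j ≠ 0).erase i, by simp, ?_,
    fun g => -(w i)⁻¹ * ∑ j, w j.1 * g j, ?_⟩
  · rw [Finset.card_erase_of_mem hi']
    have : (Finset.univ.filter fun j => w j ≠ 0).card = r + 1 := hr
    omega
  · intro c hc
    have h0 := hw c hc
    have hsum : w ⬝ᵥ c = ∑ j ∈ Finset.univ.filter (fun j => w j ≠ 0), w j * c j := by
      rw [dotProduct, Finset.sum_filter_of_ne]
      intro j _ hj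
      exact left_ne_zero_of_mul hj
    rw [hsum, ← Finset.add_sum_erase _ _ hi'] at h0
    have hs := Finset.sum_coe_sort ((Finset.univ.filter fun j => w j ≠ 0).erase i)
      (fun j => w j * c j)
    simp only [hs]
    rw [eq_neg_of_add_eq_zero_right h0]
    field_simp

theorem IsLRC.isDOptimalLRC {C : Submodule F (Fin n → F)} {d q r : ℕ}
    (h : IsLRC C (r + 1) d q r) (hr : 2 ≤ r) (hn : n = d + (r + 1)) :
    IsDOptimalLRC C (r + 1) d q r := by
  refine ⟨h, ?_⟩
  have hr' : (2 : ℚ) ≤ r := by exact_mod_cast hr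
  have hceil : ⌈((r + 1 : ℕ) : ℚ) / (r : ℚ)⌉ = 2 := by
    rw [Int.ceil_eq_iff]
    push_cast
    constructor
    · rw [lt_div_iff₀ (by linarith)]
      linarith
    · rw [div_le_iff₀ (by linarith)]
      linarith
  rw [hceil, hn]
  push_cast
  ring

theorem IsLRC.isKOptimalLRC {C : Submodule F (Fin n → F)} {d q r : ℕ}
    (h : IsLRC C (r + 1) d q r) (hr : 1 ≤ r) (hd : 1 ≤ d) (hn : n = d + (r + 1)) :
    IsKOptimalLRC C (r + 1) d q r := by
  have h1 : kOpt F (n - 1 * (r + 1)) d = 1 := by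
    rw [one_mul, hn, Nat.add_sub_cancel, kOpt_self hd]
  refine ⟨h, ⟨1, le_rfl, by rw [h1, mul_one]⟩, ?_⟩
  rintro b ⟨t, ht, rfl⟩
  obtain rfl | ht := ht.eq_or_lt
  · rw [h1, mul_one]
  · have : r * 2 ≤ r * t := Nat.mul_le_mul_left r ht
    omega

end Codes

/-! ### The point set in the projective plane -/

/-- The points that index the coordinates of the code: the affine points of the conic `y² = xz`, its
point at infinity, its nucleus in characteristic two, and two further points. -/
inductive Point (F : Type*)
  | conic (a : F)
  | infinity
  | nucleus
  | extra₁
  | extra₂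

namespace Point

variable {F : Type*} [Field F]

/-- Homogeneous coordinates, normalized so that the first nonzero coordinate is `1`. -/
def vec : Point F → Fin 3 → F
  | conic a => ![1, a, a ^ 2]
  | infinity => ![0, 0, 1]
  | nucleus => ![0, 1, 0]
  | extra₁ => ![1, 0, 1]
  | extra₂ => ![0, 1, 1]

theorem vec_ne_zero (p : Point F) : p.vec ≠ 0 := by
  intro h
  have h0 := congrFun h 0
  have h1 := congrFun h 1
  have h2 := congrFun h 2
  cases p <;> simp [vec] at h0 h1 h2

/-- Distinct points have independent homogeneous coordinates. -/
theorem eq_of_smul_vec_add_smul_vec {p p' : Point F} {x y : F} (hx : x ≠ 0)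
    (h : x • p.vec + y • p'.vec = 0) : p = p' := by
  have h0 := congrFun h 0
  have h1 := congrFun h 1
  have h2 := congrFun h 2
  cases p <;> cases p' <;> simp [vec] at h0 h1 h2 ⊢ <;> grind

/-- A line contains at most three of the points. -/
theorem exists_eq_of_dotProduct_eq_zero [CharP F 2] (hroot : ∀ a : F, 1 + a + a ^ 2 ≠ 0)
    {u : Fin 3 → F} (hu : u ≠ 0) :
    ∃ p₁ p₂ p₃ : Point F, ∀ p : Point F, u ⬝ᵥ p.vec = 0 → p = p₁ ∨ p = p₂ ∨ p = p₃ := by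
  have h2 : (2 : F) = 0 := CharTwo.two_eq_zero
  have hu' : ¬ (u 0 = 0 ∧ u 1 = 0 ∧ u 2 = 0) := by
    rintro ⟨h0, h1, h2⟩
    exact hu (funext fun i => by fin_cases i <;> assumption)
  generalize hx : u 0 = x at hu'
  generalize hy : u 1 = y at hu'
  generalize hz : u 2 = z at hu'
  have hdot : ∀ p : Point F, u ⬝ᵥ p.vec = x * p.vec 0 + y * p.vec 1 + z * p.vec 2 := by
    intro p
    simp [dotProduct, Fin.sum_univ_three, hx, hy, hz]
  simp only [hdot]
  by_cases hr : ∃ a, x + y * a + z * a ^ 2 = 0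
  · obtain ⟨a, ha⟩ := hr
    by_cases hz0 : z = 0
    · refine ⟨conic a, infinity, extra₁, fun p hp => ?_⟩
      cases p <;> simp [vec] at hp ⊢ <;> grind
    by_cases hy0 : y = 0
    · refine ⟨conic a, nucleus, extra₁, fun p hp => ?_⟩
      cases p <;> simp [vec] at hp ⊢ <;> grind
    -- The two roots of `x + y T + z T²` have sum `y / z`.
    by_cases hxz : x + z = 0
    · refine ⟨conic a, conic (y / z + a), extra₁, fun p hp => ?_⟩
      cases p <;> simp [vec] at hp ⊢ <;> grind
    · refine ⟨conic a, conic (y / z + a), extra₂, fun p hp => ?_⟩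
      cases p <;> simp [vec] at hp ⊢ <;> grind
  · by_cases hz0 : z = 0
    · have hy0 : y = 0 := by
        by_contra hy0
        exact hr ⟨-x / y, by rw [hz0]; field_simp; ring⟩
      refine ⟨infinity, nucleus, extra₂, fun p hp => ?_⟩
      cases p <;> simp [vec] at hp ⊢ <;> grind
    · refine ⟨nucleus, extra₁, extra₂, fun p hp => ?_⟩
      cases p <;> simp [vec] at hp ⊢ <;> grind

/-- Every point is collinear with two others. -/
theorem exists_collinear [CharP F 2] (p : Point F) :
    ∃ p' p'' : Point F, p ≠ p' ∧ p ≠ p'' ∧ p' ≠ p'' ∧ ∃ x y z : F, x ≠ 0 ∧ y ≠ 0 ∧ z ≠ 0 ∧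
      x • p.vec + y • p'.vec + z • p''.vec = 0 := by
  have h2 : (2 : F) = 0 := CharTwo.two_eq_zero
  have key : ∀ p p' p'' : Point F, ∀ x y z : F, (∀ i : Fin 3,
      x * p.vec i + y * p'.vec i + z * p''.vec i = 0) →
      x • p.vec + y • p'.vec + z • p''.vec = 0 := fun _ _ _ _ _ _ h => funext h
  cases p with
  | conic a =>
    by_cases ha0 : a = 0
    · refine ⟨infinity, extra₁, by simp, by simp, by simp, 1, 1, 1, by simp, by simp, by simp,
        key _ _ _ _ _ _ fun i => ?_⟩
      fin_cases i <;> simp [vec] <;> grind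
    by_cases ha1 : a = 1
    · refine ⟨nucleus, extra₁, by simp, by simp, by simp, 1, 1, 1, by simp, by simp, by simp,
        key _ _ _ _ _ _ fun i => ?_⟩
      fin_cases i <;> simp [vec] <;> grind
    -- The line through `(1, a, a²)` and `(1, 0, 1)` meets the conic again at the parameter `a⁻¹`.
    · refine ⟨conic a⁻¹, extra₁, by simp; grind, by simp, by simp, 1, a ^ 2, 1 + a ^ 2, by simp,
        by simpa using ha0, by grind, key _ _ _ _ _ _ fun i => ?_⟩
      fin_cases i <;> simp [vec] <;> grind
  | infinity =>
    refine ⟨conic 0, extra₁, by simp, by simp, by simp, 1, 1, 1, by simp, by simp, by simp,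
      key _ _ _ _ _ _ fun i => ?_⟩
    fin_cases i <;> simp [vec] <;> grind
  | nucleus =>
    refine ⟨conic 1, extra₁, by simp, by simp, by simp, 1, 1, 1, by simp, by simp, by simp,
      key _ _ _ _ _ _ fun i => ?_⟩
    fin_cases i <;> simp [vec] <;> grind
  | extra₁ =>
    refine ⟨conic 0, infinity, by simp, by simp, by simp, 1, 1, 1, by simp, by simp, by simp,
      key _ _ _ _ _ _ fun i => ?_⟩
    fin_cases i <;> simp [vec] <;> grind
  | extra₂ =>
    refine ⟨nucleus, infinity, by simp, by simp, by simp, 1, 1, 1, by simp, by simp, by simp,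
      key _ _ _ _ _ _ fun i => ?_⟩
    fin_cases i <;> simp [vec] <;> grind

/-- For every point there is a line off that point containing three others. -/
theorem exists_line [CharP F 2] (p : Point F) :
    ∃ (u : Fin 3 → F) (p₁ p₂ p₃ : Point F), p₁ ≠ p₂ ∧ p₁ ≠ p₃ ∧ p₂ ≠ p₃ ∧
      u ⬝ᵥ p₁.vec = 0 ∧ u ⬝ᵥ p₂.vec = 0 ∧ u ⬝ᵥ p₃.vec = 0 ∧ u ⬝ᵥ p.vec ≠ 0 := by
  have h2 : (1 + 1 : F) = 0 := CharTwo.add_self_eq_zero 1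
  -- The lines `y = 0`, `x = 0` and `x + z = 0` have no common point.
  by_cases hy : p.vec 1 = 0
  · by_cases hx : p.vec 0 = 0
    · refine ⟨![1, 0, 1], conic 1, nucleus, extra₁, by simp, by simp, by simp, ?_, ?_, ?_, ?_⟩
      on_goal 4 => cases p
      all_goals simp_all [vec, dotProduct, Fin.sum_univ_three]
    · refine ⟨![1, 0, 0], nucleus, infinity, extra₂, by simp, by simp, by simp, ?_, ?_, ?_, ?_⟩
      all_goals simp_all [vec, dotProduct, Fin.sum_univ_three]
  · refine ⟨![0, 1, 0], conic 0, infinity, extra₁, by simp, by simp, by simp, ?_, ?_, ?_, ?_⟩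
    all_goals simp_all [vec, dotProduct, Fin.sum_univ_three]

end Point

/-! ### The code whose coordinates are indexed by the points -/

section PointCode

variable {F : Type*} [Field F] {n : ℕ}

theorem rowCode_eq_range {k : ℕ} (G : Matrix (Fin k) (Fin n) F) :
    rowCode G = LinearMap.range G.vecMulLinear :=
  (range_vecMulLinear G).symm

theorem mem_rowCode_iff {k : ℕ} {G : Matrix (Fin k) (Fin n) F} {c : Fin n → F} :
    c ∈ rowCode G ↔ ∃ u : Fin k → F, c = Matrix.vecMul u G := by
  rw [rowCode_eq_range]
  exact ⟨fun ⟨u, hu⟩ => ⟨u, hu.symm⟩, fun ⟨u, hu⟩ => ⟨u, hu.symm⟩⟩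

theorem mem_dualCode_rowCode_iff {k : ℕ} {G : Matrix (Fin k) (Fin n) F} {x : Fin n → F} :
    x ∈ dualCode (rowCode G) ↔ G.mulVec x = 0 := by
  constructor
  · intro hx
    funext i
    rw [Matrix.mulVec, dotProduct_comm]
    exact hx _ (Submodule.subset_span ⟨i, rfl⟩)
  · intro hx c hc
    obtain ⟨u, rfl⟩ := mem_rowCode_iff.1 hc
    rw [dotProduct_comm, ← Matrix.dotProduct_mulVec, hx, dotProduct_zero]

theorem finrank_rowCode_add_finrank_dualCode {k : ℕ} (G : Matrix (Fin k) (Fin n) F) :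
    Module.finrank F (rowCode G) + Module.finrank F (dualCode (rowCode G)) = n := by
  have hker : dualCode (rowCode G) = LinearMap.ker G.mulVecLin := by
    ext x
    rw [mem_dualCode_rowCode_iff, LinearMap.mem_ker, Matrix.mulVecLin_apply]
  have hrank : Module.finrank F (rowCode G) = Module.finrank F (LinearMap.range G.mulVecLin) :=
    (Matrix.rank_eq_finrank_span_row G).symm
  rw [hker, hrank, LinearMap.finrank_range_add_finrank_ker, Module.finrank_fin_fun]

/-- Every nonzero codeword has at most three zeros. -/
theorem le_hammingNorm_vecMul [DecidableEq F] [CharP F 2] {G : Matrix (Fin 3) (Fin n) F}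
    {e : Fin n ≃ Point F} (hroot : ∀ a : F, 1 + a + a ^ 2 ≠ 0)
    (hG : ∀ i j, G i j = (e j).vec i) {u : Fin 3 → F} (hu : u ≠ 0) :
    n ≤ hammingNorm (Matrix.vecMul u G) + 3 := by
  obtain ⟨p₁, p₂, p₃, h⟩ := Point.exists_eq_of_dotProduct_eq_zero hroot hu
  have hzero : (Finset.univ.filter fun j => Matrix.vecMul u G j = 0).card ≤ 3 := by
    refine (Finset.card_le_card (t := {e.symm p₁, e.symm p₂, e.symm p₃}) ?_).trans
      Finset.card_le_three
    intro j hj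
    have hj' : u ⬝ᵥ (e j).vec = 0 := by
      rw [← (Finset.mem_filter.1 hj).2]
      simp [Matrix.vecMul, dotProduct, hG]
    simpa [Equiv.eq_symm_apply] using h _ hj'
  have hsplit := Finset.card_filter_add_card_filter_not (s := (Finset.univ : Finset (Fin n)))
    (fun j => Matrix.vecMul u G j = 0)
  rw [Finset.card_univ, Fintype.card_fin] at hsplit
  have : hammingNorm (Matrix.vecMul u G)
      = (Finset.univ.filter fun j => ¬ Matrix.vecMul u G j = 0).card := rfl
  omega

/-- A codeword vanishing at three distinct points has weight `n - 3`. -/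
theorem hammingNorm_vecMul_eq [DecidableEq F] [CharP F 2] {G : Matrix (Fin 3) (Fin n) F}
    {e : Fin n ≃ Point F} (hroot : ∀ a : F, 1 + a + a ^ 2 ≠ 0)
    (hG : ∀ i j, G i j = (e j).vec i) {u : Fin 3 → F} (hu : u ≠ 0) {p₁ p₂ p₃ : Point F}
    (h₁₂ : p₁ ≠ p₂) (h₁₃ : p₁ ≠ p₃) (h₂₃ : p₂ ≠ p₃) (h₁ : u ⬝ᵥ p₁.vec = 0)
    (h₂ : u ⬝ᵥ p₂.vec = 0) (h₃ : u ⬝ᵥ p₃.vec = 0) :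
    hammingNorm (Matrix.vecMul u G) + 3 = n := by
  refine le_antisymm ?_ (le_hammingNorm_vecMul hroot hG hu)
  have hvec : ∀ p, Matrix.vecMul u G (e.symm p) = u ⬝ᵥ p.vec := by
    intro p
    simp [Matrix.vecMul, dotProduct, hG]
  have hcard : ({e.symm p₁, e.symm p₂, e.symm p₃} : Finset (Fin n)).card = 3 :=
    Finset.card_eq_three.2 ⟨_, _, _, by simpa, by simpa, by simpa, rfl⟩
  have hzero := Finset.card_le_card (s := {e.symm p₁, e.symm p₂, e.symm p₃})
    (t := Finset.univ.filter fun j => Matrix.vecMul u G j = 0) (by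
      intro j hj
      simp only [Finset.mem_insert, Finset.mem_singleton] at hj
      rw [Finset.mem_filter]
      refine ⟨Finset.mem_univ _, ?_⟩
      rcases hj with rfl | rfl | rfl <;> rw [hvec] <;> assumption)
  have hsplit := Finset.card_filter_add_card_filter_not (s := (Finset.univ : Finset (Fin n)))
    (fun j => Matrix.vecMul u G j = 0)
  rw [Finset.card_univ, Fintype.card_fin] at hsplit
  have : hammingNorm (Matrix.vecMul u G)
      = (Finset.univ.filter fun j => ¬ Matrix.vecMul u G j = 0).card := rfl
  omega

theorem finrank_rowCode_eq_three [DecidableEq F] [CharP F 2] {G : Matrix (Fin 3) (Fin n) F}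
    {e : Fin n ≃ Point F} (hroot : ∀ a : F, 1 + a + a ^ 2 ≠ 0)
    (hG : ∀ i j, G i j = (e j).vec i) (hn : 4 ≤ n) :
    Module.finrank F (rowCode G) = 3 := by
  have hinj : Function.Injective G.vecMulLinear := by
    rw [injective_iff_map_eq_zero]
    intro u hu
    by_contra hu0
    have hle := le_hammingNorm_vecMul hroot hG hu0
    rw [← Matrix.vecMulLinear_apply, hu, hammingNorm_zero] at hle
    omega
  rw [rowCode_eq_range, LinearMap.finrank_range_of_inj hinj, Module.finrank_fin_fun]

theorem hasParameters_rowCode [DecidableEq F] [CharP F 2] {G : Matrix (Fin 3) (Fin n) F}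
    {e : Fin n ≃ Point F} (hroot : ∀ a : F, 1 + a + a ^ 2 ≠ 0)
    (hG : ∀ i j, G i j = (e j).vec i) (hn : 4 ≤ n) :
    HasParameters (rowCode G) 3 (n - 3) := by
  refine hasParameters_of_hammingNorm (finrank_rowCode_eq_three hroot hG hn) ?_ ?_
  · intro x hx hx0
    obtain ⟨u, rfl⟩ := mem_rowCode_iff.1 hx
    have hu : u ≠ 0 := by
      rintro rfl
      exact hx0 (Matrix.zero_vecMul G)
    have := le_hammingNorm_vecMul hroot hG hu
    omega
  · obtain ⟨u, p₁, p₂, p₃, h₁₂, h₁₃, h₂₃, h₁, h₂, h₃, hp⟩ := Point.exists_line (F := F) .nucleus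
    have hu : u ≠ 0 := by
      rintro rfl
      exact hp (zero_dotProduct _)
    have hw := hammingNorm_vecMul_eq hroot hG hu h₁₂ h₁₃ h₂₃ h₁ h₂ h₃
    refine ⟨_, mem_rowCode_iff.2 ⟨u, rfl⟩, ?_, by omega⟩
    rw [← hammingNorm_ne_zero_iff]
    omega

/-- A collinear triple of points gives a word of weight three in the dual code. -/
theorem exists_mem_dualCode [DecidableEq F] [CharP F 2] {G : Matrix (Fin 3) (Fin n) F}
    {e : Fin n ≃ Point F} (hG : ∀ i j, G i j = (e j).vec i) (j : Fin n) :
    ∃ w ∈ dualCode (rowCode G), hammingNorm w = 3 ∧ w j ≠ 0 := by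
  obtain ⟨p', p'', h₁₂, h₁₃, h₂₃, x, y, z, hx, hy, hz, h⟩ := (e j).exists_collinear
  obtain ⟨j', rfl⟩ := e.surjective p'
  obtain ⟨j'', rfl⟩ := e.surjective p''
  rw [Ne, e.apply_eq_iff_eq] at h₁₂ h₁₃ h₂₃
  refine ⟨Pi.single j x + Pi.single j' y + Pi.single j'' z, ?_, ?_, ?_⟩
  · rw [mem_dualCode_rowCode_iff]
    funext i
    have := congrFun h i
    simp only [Pi.add_apply, Pi.smul_apply, smul_eq_mul, Pi.zero_apply] at this
    simp [Matrix.mulVec_add, Matrix.mulVec_single, hG, ← this]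
  · have hsupp : (Finset.univ.filter fun i =>
        (Pi.single j x + Pi.single j' y + Pi.single j'' z : Fin n → F) i ≠ 0) = {j, j', j''} := by
      ext i
      simp only [Finset.mem_filter, Finset.mem_univ, true_and, Finset.mem_insert,
        Finset.mem_singleton, Pi.add_apply, Pi.single_apply]
      grind
    rw [hammingNorm, hsupp]
    exact Finset.card_eq_three.2 ⟨_, _, _, h₁₂, h₁₃, h₂₃, rfl⟩
  · simp [h₁₂, h₁₃, hx]

theorem three_le_hammingNorm_of_mem_dualCode [DecidableEq F] {G : Matrix (Fin 3) (Fin n) F}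
    {e : Fin n ≃ Point F} (hG : ∀ i j, G i j = (e j).vec i) {x : Fin n → F}
    (hx : x ∈ dualCode (rowCode G)) (hx0 : x ≠ 0) : 3 ≤ hammingNorm x := by
  by_contra hlt
  rw [mem_dualCode_rowCode_iff] at hx
  obtain ⟨j, hj⟩ := Function.ne_iff.1 hx0
  rw [Pi.zero_apply] at hj
  have hj' : j ∈ Finset.univ.filter fun i => x i ≠ 0 := by simpa using hj
  have hcard : ((Finset.univ.filter fun i => x i ≠ 0).erase j).card ≤ 1 := by
    rw [Finset.card_erase_of_mem hj']
    have : (Finset.univ.filter fun i => x i ≠ 0).card = hammingNorm x := rfl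
    omega
  have hsum : ∑ i ∈ Finset.univ.filter (fun i => x i ≠ 0), x i • (e i).vec = 0 := by
    rw [Finset.sum_filter_of_ne fun i _ hi => left_ne_zero_of_smul hi, ← hx]
    funext i
    simp [Matrix.mulVec, dotProduct, hG, mul_comm]
  rw [← Finset.add_sum_erase _ _ hj'] at hsum
  -- At most one other entry is nonzero, and it would give a point equal to `e j`.
  obtain h0 | h1 : ((Finset.univ.filter fun i => x i ≠ 0).erase j).card = 0 ∨
      ((Finset.univ.filter fun i => x i ≠ 0).erase j).card = 1 := by omega
  · rw [Finset.card_eq_zero.1 h0, Finset.sum_empty, add_zero, smul_eq_zero] at hsum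
    exact (e j).vec_ne_zero (hsum.resolve_left hj)
  · obtain ⟨k, hk⟩ := Finset.card_eq_one.1 h1
    rw [hk, Finset.sum_singleton] at hsum
    have hkj : k ∈ (Finset.univ.filter fun i => x i ≠ 0).erase j := by simp [hk]
    exact Finset.ne_of_mem_erase hkj
      (e.injective (Point.eq_of_smul_vec_add_smul_vec hj hsum)).symm

theorem hasParameters_dualCode_rowCode [DecidableEq F] [CharP F 2]
    {G : Matrix (Fin 3) (Fin n) F} {e : Fin n ≃ Point F} (hroot : ∀ a : F, 1 + a + a ^ 2 ≠ 0)
    (hG : ∀ i j, G i j = (e j).vec i) (hn : 4 ≤ n) :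
    HasParameters (dualCode (rowCode G)) (n - 3) 3 := by
  have hrank := finrank_rowCode_add_finrank_dualCode G
  rw [finrank_rowCode_eq_three hroot hG hn] at hrank
  refine hasParameters_of_hammingNorm (by omega)
    (fun x hx hx0 => three_le_hammingNorm_of_mem_dualCode hG hx hx0) ?_
  obtain ⟨w, hw, h3, -⟩ := exists_mem_dualCode hG ⟨0, by omega⟩
  refine ⟨w, hw, ?_, h3⟩
  rw [← hammingNorm_ne_zero_iff]
  omega

theorem hasLocality_rowCode [CharP F 2] {G : Matrix (Fin 3) (Fin n) F} {e : Fin n ≃ Point F}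
    (hG : ∀ i j, G i j = (e j).vec i) : HasLocality (rowCode G) 2 := by
  classical
  refine hasLocality_of_orthogonal fun j => ?_
  obtain ⟨w, hw, h3, hj⟩ := exists_mem_dualCode hG j
  exact ⟨w, hw, h3, hj⟩

theorem hasLocality_dualCode_rowCode [CharP F 2] {G : Matrix (Fin 3) (Fin n) F}
    {e : Fin n ≃ Point F} (hroot : ∀ a : F, 1 + a + a ^ 2 ≠ 0)
    (hG : ∀ i j, G i j = (e j).vec i) (hn : 4 ≤ n) :
    HasLocality (dualCode (rowCode G)) (n - 4) := by
  classical
  refine hasLocality_of_orthogonal fun j => ?_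
  obtain ⟨u, p₁, p₂, p₃, h₁₂, h₁₃, h₂₃, h₁, h₂, h₃, hj⟩ := (e j).exists_line
  have hu : u ≠ 0 := by
    rintro rfl
    exact hj (zero_dotProduct _)
  have hw := hammingNorm_vecMul_eq hroot hG hu h₁₂ h₁₃ h₂₃ h₁ h₂ h₃
  refine ⟨Matrix.vecMul u G, fun c hc => ?_, by omega, ?_⟩
  · rw [dotProduct_comm]
    exact hc _ (mem_rowCode_iff.2 ⟨u, rfl⟩)
  · simpa [Matrix.vecMul, dotProduct, hG] using hj

end PointCode

/-! ### The columns of the generator matrix -/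

section GenMatrix

variable {F : Type*} [Field F] {q : ℕ}

/-- The point whose homogeneous coordinates form the column `j` of the generator matrix. -/
def columnPoint (α : Fin q → F) (j : Fin (q + 4)) : Point F :=
  if h : (j : ℕ) + 1 < q then .conic (α ⟨j + 1, h⟩)
  else if (j : ℕ) + 1 = q then .conic 0
  else if (j : ℕ) = q then .infinity
  else if (j : ℕ) = q + 1 then .nucleus
  else if (j : ℕ) = q + 2 then .extra₁
  else .extra₂

theorem genMatrix_apply (α : Fin q → F) (i : Fin 3) (j : Fin (q + 4)) :
    genMatrix α i j = (columnPoint α j).vec i := by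
  simp only [genMatrix, columnPoint, Matrix.of_apply]
  split_ifs <;> simp [Point.vec]

theorem bijective_columnPoint (α : Fin q ≃ F) (hα : ((α.symm 0 : Fin q) : ℕ) = 0) :
    Function.Bijective (columnPoint α) := by
  have hne : ∀ i : Fin q, (i : ℕ) ≠ 0 → α i ≠ 0 := by
    intro i hi h
    rw [← h, Equiv.symm_apply_apply] at hα
    exact hi hα
  have hq : 0 < q := (α.symm 0).pos
  constructor
  · intro j k h
    have hj := j.isLt
    have hk := k.isLt
    unfold columnPoint at h
    split_ifs at h <;> simp only [Point.conic.injEq] at h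
    all_goals first
      | exact Fin.ext (by omega)
      | (have := congrArg Fin.val (α.injective h)
         exact Fin.ext (by simpa using this))
      | exact absurd h (hne _ (by simp))
      | exact absurd h.symm (hne _ (by simp))
  · intro p
    cases p with
    | conic a =>
      by_cases ha : a = 0
      · exact ⟨⟨q - 1, by omega⟩, by simp [columnPoint, ha, show q - 1 + 1 = q by omega]⟩
      · have h0 : ((α.symm a : Fin q) : ℕ) ≠ 0 := by
          intro h
          exact ha (α.symm.injective (Fin.ext (h.trans hα.symm)))
        have hlt := (α.symm a).isLt
        refine ⟨⟨(α.symm a : ℕ) - 1, by omega⟩, ?_⟩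
        have h1 : (α.symm a : ℕ) - 1 + 1 = α.symm a := by omega
        simp [columnPoint, h1]
    | infinity => exact ⟨⟨q, by omega⟩, by simp [columnPoint]⟩
    | nucleus => exact ⟨⟨q + 1, by omega⟩, by simp [columnPoint, add_assoc]⟩
    | extra₁ => exact ⟨⟨q + 2, by omega⟩, by simp [columnPoint, add_assoc]⟩
    | extra₂ => exact ⟨⟨q + 3, by omega⟩, by simp [columnPoint, add_assoc]⟩

end GenMatrix

/-! ### Finite fields of order `2 ^ m` with `m` odd -/

theorem charP_two_of_card {F : Type*} [Field F] [Finite F] {m : ℕ} (hm : m ≠ 0)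
    (hF : Nat.card F = 2 ^ m) : CharP F 2 := by
  have := Fintype.ofFinite F
  refine CharTwo.of_one_ne_zero_of_two_eq_zero one_ne_zero ?_
  have h := FiniteField.cast_card_eq_zero F
  rw [← Nat.card_eq_fintype_card, hF, Nat.cast_pow] at h
  simpa [hm] using h

/-- A root `a` satisfies `a³ = 1`, hence `a = a ^ q = a²` since `q ≡ 2` modulo `3`, so `a` would be
`0` or `1`. -/
theorem one_add_add_sq_ne_zero {F : Type*} [Field F] [Finite F] {m : ℕ} (hm : Odd m)
    (hF : Nat.card F = 2 ^ m) (a : F) : 1 + a + a ^ 2 ≠ 0 := by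
  have := Fintype.ofFinite F
  obtain ⟨k, rfl⟩ := hm
  have := charP_two_of_card (by omega) hF
  have h2 : (2 : F) = 0 := CharTwo.two_eq_zero
  intro h
  have h3 : a ^ 3 = 1 := by grind
  have hmod : 2 ^ (2 * k + 1) % 3 = 2 := by
    rw [pow_succ, pow_mul, Nat.mul_mod, Nat.pow_mod]
    simp
  have hpow : a ^ (2 ^ (2 * k + 1)) = a := by
    rw [← hF, Nat.card_eq_fintype_card, FiniteField.pow_card]
  rw [← Nat.div_add_mod (2 ^ (2 * k + 1)) 3, hmod, pow_add, pow_mul, h3, one_pow, one_mul] at hpow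
  grind

end LocallyRecoverable

theorem mainTheorem12 (m q : ℕ) (hm : 3 ≤ m) (hodd : Odd m) (hq : q = 2 ^ m)
    {F : Type*} [Field F] [DecidableEq F] (hF : Nat.card F = q)
    (α : Fin q ≃ F) (hα0 : ((α.symm 0 : Fin q) : ℕ) = 0) (hα1 : ((α.symm 1 : Fin q) : ℕ) = 1)
    (C : Submodule F (Fin (q + 4) → F))
    (hC : C = LocallyRecoverable.rowCode (LocallyRecoverable.genMatrix α)) :
    LocallyRecoverable.IsNMDS C ∧
    LocallyRecoverable.IsLRC C 3 (q + 1) q 2 ∧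
    LocallyRecoverable.IsLRC (LocallyRecoverable.dualCode C) (q + 1) 3 q q ∧
    LocallyRecoverable.IsDOptimalLRC C 3 (q + 1) q 2 ∧
    LocallyRecoverable.IsKOptimalLRC C 3 (q + 1) q 2 ∧
    LocallyRecoverable.IsDOptimalLRC (LocallyRecoverable.dualCode C) (q + 1) 3 q q ∧
    LocallyRecoverable.IsKOptimalLRC (LocallyRecoverable.dualCode C) (q + 1) 3 q q := by
  open LocallyRecoverable in
  subst hC
  have hq2 : 2 ≤ q := hq ▸ (Nat.le_self_pow (by omega) 2)
  have : Finite F := Finite.of_equiv _ α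
  have : CharP F 2 := charP_two_of_card (by omega) (hF.trans hq)
  have hroot := one_add_add_sq_ne_zero hodd (hF.trans hq)
  have hG : ∀ i j, genMatrix α i j
      = (Equiv.ofBijective _ (bijective_columnPoint α hα0) j).vec i := genMatrix_apply α
  have hpar : HasParameters (rowCode (genMatrix α)) 3 (q + 1) :=
    hasParameters_rowCode hroot hG (by omega)
  have hpar' : HasParameters (dualCode (rowCode (genMatrix α))) (q + 1) 3 :=
    hasParameters_dualCode_rowCode hroot hG (by omega)
  have hlrc : IsLRC (rowCode (genMatrix α)) 3 (q + 1) q 2 := ⟨hF, hpar, hasLocality_rowCode hG⟩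
  have hlrc' : IsLRC (dualCode (rowCode (genMatrix α))) (q + 1) 3 q q :=
    ⟨hF, hpar', hasLocality_dualCode_rowCode hroot hG (by omega)⟩
  exact ⟨⟨⟨3, q + 1, hpar, by omega⟩, ⟨q + 1, 3, hpar', by omega⟩⟩, hlrc, hlrc',
    hlrc.isDOptimalLRC (by omega) (by omega), hlrc.isKOptimalLRC (by omega) (by omega) (by omega),
    hlrc'.isDOptimalLRC (by omega) (by omega), hlrc'.isKOptimalLRC (by omega) (by omega) (by omega)⟩
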